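/- **Theorem (quasi-affine frames).** For $\alpha\in\mathbb{R}^d$ and an invertible real $d\times d$ matrix $M$ define operators on $L^2(\mathbb{R}^d)$ by $$T_\alpha f=f(\cdot-\alpha),\qquad D_Mf=|\det M|^{1/2}f(M\,\cdot),\qquad \widetilde D_Mf=|\det M|\,f(M\,\cdot).$$ Let $A,B$ be expansive real $d\times d$ matrices (all complex eigenvalues have modulus greater than one), let $X,Y$ be nonsingular real $d\times d$ matrices, and let $\Psi=\{\psi_1,\dots,\psi_n\}$, $\Phi=\{\varphi_1,\dots,\varphi_n\}\subset L^2(\mathbb{R}^d)$. The quasi-affine system $\mathcal U^q(\Psi)$ is the family $(u_{j,m,z})$, indexed by $j\in\{1,\dots,n\}$, $m\in\mathbb{Z}$, $z\in\mathbb{Z}^d$, with $$u_{j,m,z}=D_{A^m}T_{Xz}\psi_j\ \ (m\ge 0),\qquad u_{j,m,z}=T_{Xz}\widetilde D_{A^m}\psi_j\ \ (m<0),$$ and $\mathcal U^q(\Phi)$ is defined in the same way from $B$, $Y$, $\Phi$. Suppose that both families are frames for $L^2(\mathbb{R}^d)$, i.e. each family $(u_i)$ satisfies $C_1\|f\|^2\le\sum_i|\langle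 f,u_i\rangle|^2\le C_2\|f\|^2$ for all $f\in L^2(\mathbb{R}^d)$ with some constants $C_1,C_2>0$. Let $\Theta^q_\Psi,\Theta^q_\Phi:L^2(\mathbb{R}^d)\to\ell^2(\{1,\dots,n\}\times\mathbb{Z}\times\mathbb{Z}^d)$ be their analysis operators $f\mapsto(\langle f,u_i\rangle)_i$. For an integer $r\le 0$ and $1\le j\le n$ put $$m_j^r(\xi)=\sum_{k\in\mathbb{Z}^d}\bigl|\hat\psi_j\bigl(A^{*-r}X^{*-1}(\xi+k)\bigr)\bigr|^2,\qquad n_j^r(\xi)=\sum_{k\in\mathbb{Z}^d}\bigl|\hat\varphi_j\bigl(B^{*-r}Y^{*-1}(\xi+k)\bigr)\bigr|^2,$$ where $A^{*-r}=(A^*)^{-r}$, $X^{*-1}=(X^*)^{-1}$ and $\hat f$ is the Fourier (Plancherel) transform with $\hat f(\xi)=\int f(x)e^{-2\pi i\langle\xi,x\rangle}\,dx$ on $L^1\cap L^2$. Let $E_j^r=\{\xi: m_j^r(\xi)\neq 0\}$ and $F_j^r=\{\xi: n_j^r(\xi)\ne 0\}$, and let $\lambda$ be Lebesgue measure on $\mathbb{R}^d$.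 Then: 1. if $\Theta^q_\Psi(L^2(\mathbb{R}^d))\subset\Theta^q_\Phi(L^2(\mathbb{R}^d))$, then $\lambda(E_j^r\setminus F_j^r)=0$ for all $j=1,\dots,n$ and all integers $r\le 0$; 2. if $\Theta^q_\Psi(L^2(\mathbb{R}^d))=\Theta^q_\Phi(L^2(\mathbb{R}^d))$, then $\lambda(E_j^r\,\triangle\,F_j^r)=0$ for all $j=1,\dots,n$ and all integers $r\le 0$; 3. if $\lambda(E_j^r\cap F_j^r)=0$ for all $j=1,\dots,n$ and all integers $r\le 0$, then $\Theta^q_\Psi(L^2(\mathbb{R}^d))\perp\Theta^q_\Phi(L^2(\mathbb{R}^d))$. -/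

import Mathlib

open MeasureTheory
open scoped ENNReal FourierTransform Matrix InnerProductSpace

namespace QuasiAffine

section Frames

variable {ι H : Type*} [NormedAddCommGroup H] [InnerProductSpace ℂ H]

/-- A family `u` in a Hilbert space is a frame if there are constants `0 < C₁, C₂` with
`C₁ ‖f‖² ≤ ∑ᵢ |⟨f, uᵢ⟩|² ≤ C₂ ‖f‖²` for all `f`, the sum being convergent.
(Mathlib's inner product is linear in the second argument, so `⟨f, uᵢ⟩` is `inner ℂ (u i) f`.) -/
def IsFrame (u : ι → H) : Prop :=
  ∃ C₁ C₂ : ℝ, 0 < C₁ ∧ 0 < C₂ ∧ ∀ f : H,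
    Summable (fun i => ‖inner ℂ (u i) f‖ ^ 2) ∧
    C₁ * ‖f‖ ^ 2 ≤ ∑' i, ‖inner ℂ (u i) f‖ ^ 2 ∧
    ∑' i, ‖inner ℂ (u i) f‖ ^ 2 ≤ C₂ * ‖f‖ ^ 2

theorem IsFrame.memℓp {u : ι → H} (hu : IsFrame u) (f : H) :
    Memℓp (fun i => inner ℂ (u i) f) 2 := by
  obtain ⟨_, _, _, _, h⟩ := hu
  refine memℓp_gen ?_
  simpa using (h f).1

/-- The analysis operator `f ↦ (⟨f, uᵢ⟩)ᵢ` of a frame, with values in `ℓ²(ι)`. -/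
noncomputable def analysisOperator {u : ι → H} (hu : IsFrame u) :
    H →ₗ[ℂ] lp (fun _ : ι => ℂ) 2 where
  toFun f := ⟨fun i => inner ℂ (u i) f, hu.memℓp f⟩
  map_add' f g := by
    ext i
    exact inner_add_right _ _ _
  map_smul' c f := by
    ext i
    exact inner_smul_right _ _ _

end Frames

/-- The Hilbert space `L²(ℝᵈ)` of complex-valued functions. -/
abbrev L2 (d : ℕ) : Type := Lp ℂ 2 (volume : Measure (EuclideanSpace ℝ (Fin d)))

variable {d : ℕ}

/-- The action `x ↦ M x` of a real matrix on `ℝᵈ`. -/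
noncomputable def act (M : Matrix (Fin d) (Fin d) ℝ) (x : EuclideanSpace ℝ (Fin d)) :
    EuclideanSpace ℝ (Fin d) :=
  Matrix.toEuclideanLin M x

/-- The lattice point `z ∈ ℤᵈ`, seen in `ℝᵈ`. -/
noncomputable def latticePt (z : Fin d → ℤ) : EuclideanSpace ℝ (Fin d) :=
  WithLp.toLp 2 (fun i => (z i : ℝ))

/-- A real square matrix is expansive if all its (complex) eigenvalues have modulus `> 1`. -/
def IsExpansive (A : Matrix (Fin d) (Fin d) ℝ) : Prop :=
  ∀ μ ∈ spectrum ℂ (A.map (algebraMap ℝ ℂ)), 1 < ‖μ‖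

theorem det_toEuclideanLin_ne_zero (M : GL (Fin d) ℝ) :
    LinearMap.det (Matrix.toEuclideanLin (M : Matrix (Fin d) (Fin d) ℝ)) ≠ 0 := by
  change LinearMap.det (Matrix.toLpLin 2 2 (M : Matrix (Fin d) (Fin d) ℝ)) ≠ 0
  rw [Matrix.toLpLin_eq_toLin, LinearMap.det_toLin]
  exact (M.isUnit.map Matrix.detMonoidHom).ne_zero

theorem memLp_comp_act (M : GL (Fin d) ℝ) (f : L2 d) :
    MemLp (fun x => f (act (M : Matrix (Fin d) (Fin d) ℝ) x)) 2 volume := by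
  have h := Measure.map_linearMap_addHaar_eq_smul_addHaar
    (volume : Measure (EuclideanSpace ℝ (Fin d))) (det_toEuclideanLin_ne_zero M)
  have hf : MemLp f 2 (Measure.map
      (Matrix.toEuclideanLin (M : Matrix (Fin d) (Fin d) ℝ)) volume) := by
    rw [h]
    exact (Lp.memLp f).smul_measure ENNReal.ofReal_ne_top
  exact hf.comp_of_map (LinearMap.continuous_of_finiteDimensional
    (Matrix.toEuclideanLin (M : Matrix (Fin d) (Fin d) ℝ))).measurable.aemeasurable

/-- The element `x ↦ f (M x)` of `L²(ℝᵈ)`, for an invertible matrix `M`. -/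
noncomputable def compAct (M : GL (Fin d) ℝ) (f : L2 d) : L2 d :=
  (memLp_comp_act M f).toLp

/-- The translation operator `T_α f = f(· - α)`. -/
noncomputable def translation (α : EuclideanSpace ℝ (Fin d)) (f : L2 d) : L2 d :=
  Lp.compMeasurePreserving (fun x => x - α) (measurePreserving_sub_right volume α) f

/-- The unitary dilation `D_M f = |det M|^{1/2} f(M ·)`. -/
noncomputable def dilation (M : GL (Fin d) ℝ) (f : L2 d) : L2 d :=
  ((√|(M : Matrix (Fin d) (Fin d) ℝ).det| : ℝ) : ℂ) • compAct M f

/-- The `L¹`-normalized dilation `D̃_M f = |det M| f(M ·)`. -/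
noncomputable def dilationL1 (M : GL (Fin d) ℝ) (f : L2 d) : L2 d :=
  ((|(M : Matrix (Fin d) (Fin d) ℝ).det| : ℝ) : ℂ) • compAct M f

/-- The quasi-affine system with dilation matrix `A`, translation matrix `X` and generators
`ψ₁, …, ψₙ`: the entry at `(j, m, z)` is `D_{A^m} T_{Xz} ψ_j` if `m ≥ 0` and
`T_{Xz} D̃_{A^m} ψ_j` if `m < 0`. -/
noncomputable def quasiAffineSystem {n : ℕ} (A X : GL (Fin d) ℝ) (ψ : Fin n → L2 d) :
    Fin n × ℤ × (Fin d → ℤ) → L2 d :=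
  fun p =>
    if 0 ≤ p.2.1 then dilation (A ^ p.2.1) (translation (act X (latticePt p.2.2)) (ψ p.1))
    else translation (act X (latticePt p.2.2)) (dilationL1 (A ^ p.2.1) (ψ p.1))

/-- `∑_{k ∈ ℤᵈ} |ψ̂(A^{*-r} X^{*-1} (ξ + k))|²`, a sum in `[0, ∞]`, where `ψ̂` is (a representative
of) the Fourier–Plancherel transform of `ψ`. -/
noncomputable def periodization (A X : GL (Fin d) ℝ) (ψ : L2 d) (r : ℤ)
    (ξ : EuclideanSpace ℝ (Fin d)) : ℝ≥0∞ :=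
  ∑' k : Fin d → ℤ,
    ‖(𝓕 ψ : L2 d) (act ((A : Matrix (Fin d) (Fin d) ℝ)ᵀ ^ (-r) *
      ((X : Matrix (Fin d) (Fin d) ℝ)ᵀ)⁻¹) (ξ + latticePt k))‖ₑ ^ 2

/-- The set of points at which `periodization A X ψ r` does not vanish. -/
def supportSet (A X : GL (Fin d) ℝ) (ψ : L2 d) (r : ℤ) : Set (EuclideanSpace ℝ (Fin d)) :=
  {ξ | periodization A X ψ r ξ ≠ 0}

end QuasiAffine

/-! Fix a level `(j, m)` and put r = min(m, 0). Write σ for `symbol`, that is ψ̂_j(A^{*-r} X^{*-1}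
·). By Plancherel, the coefficients of f at this level are, up to a nonzero constant and z ↦ -z, the
Fourier coefficients on the torus of the periodization P_f of conj(σ) · Sf, where S maps onto L²
(`exists_inner_quasiAffineSystem_eq`). P_f vanishes wherever σ vanishes on the whole fibre t + ℤᵈ,
so it lives on E_j^r modulo ℤᵈ.

Inclusion: choose f with Sf = σ, so that P_f = m_j^r. If g has the same coefficients in the second
system, uniqueness for L¹ functions makes m_j^r a constant multiple of the periodization P'_g of g,
which lives on F_j^r. Equality of ranges uses this in both directions.

Orthogonality: by Parseval, each level contributes a multiple of ∫ conj(P_f) P'_g, and the two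
factors have essentially disjoint supports. A priori P_f is only in L¹; the frame property makes its
coefficients square-summable, which puts it in L². -/

/-! ### Fourier uniqueness and Parseval for integrable functions on the torus -/

section Torus

open scoped ComplexConjugate
open UnitAddTorus

attribute [local instance] instMeasureSpaceUnitAddCircle

theorem isProbabilityMeasure_volume_unitAddCircle :
    IsProbabilityMeasure (volume : Measure UnitAddCircle) :=
  inferInstanceAs (IsProbabilityMeasure AddCircle.haarAddCircle)

attribute [local instance] isProbabilityMeasure_volume_unitAddCircle

namespace UnitAddTorus

variable {ι : Type*} [Fintype ι] {f g : UnitAddTorus ι → ℂ}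

theorem integrable_continuousMap_mul (hf : Integrable f) (φ : C(UnitAddTorus ι, ℂ)) :
    Integrable (fun t => φ t * f t) :=
  hf.bdd_mul φ.continuous.aestronglyMeasurable (.of_forall φ.norm_coe_le_norm)

theorem mFourierCoeff_sub (hf : Integrable f) (hg : Integrable g) (z : ι → ℤ) :
    mFourierCoeff (f - g) z = mFourierCoeff f z - mFourierCoeff g z := by
  simp only [mFourierCoeff, Pi.sub_apply, smul_eq_mul, mul_sub]
  exact integral_sub (integrable_continuousMap_mul hf _) (integrable_continuousMap_mul hg _)

/-- Pairing with an L¹ function is continuous in the sup norm, so its kernel is closed; it contains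
the characters, whose span is dense. -/
theorem integral_continuousMap_mul_eq_zero (hf : Integrable f)
    (h : ∀ z, mFourierCoeff f z = 0) (φ : C(UnitAddTorus ι, ℂ)) :
    ∫ t, φ t * f t = 0 := by
  let L : C(UnitAddTorus ι, ℂ) →L[ℂ] ℂ := LinearMap.mkContinuous
    { toFun := fun φ => ∫ t, φ t * f t
      map_add' := fun a b => by
        simp only [ContinuousMap.add_apply, add_mul]
        exact integral_add (integrable_continuousMap_mul hf a) (integrable_continuousMap_mul hf b)
      map_smul' := fun c a => by
        simp only [ContinuousMap.smul_apply, smul_eq_mul, mul_assoc, RingHom.id_apply]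
        exact integral_const_mul _ _ }
    (∫ t, ‖f t‖) fun φ => by
      refine (norm_integral_le_integral_norm _).trans ?_
      rw [← integral_mul_const]
      refine integral_mono (integrable_continuousMap_mul hf φ).norm (hf.norm.mul_const _)
        fun t => ?_
      dsimp only
      rw [norm_mul, mul_comm]
      exact mul_le_mul_of_nonneg_left (φ.norm_coe_le_norm t) (norm_nonneg _)
  have hmem : φ ∈ (Submodule.span ℂ (Set.range (mFourier (d := ι)))).topologicalClosure := by
    rw [span_mFourier_closure_eq_top]; trivial
  have hle : (Submodule.span ℂ (Set.range (mFourier (d := ι)))).topologicalClosure ≤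
      LinearMap.ker L.toLinearMap := by
    refine Submodule.topologicalClosure_minimal _ (Submodule.span_le.2 ?_) L.isClosed_ker
    rintro _ ⟨z, rfl⟩
    have hz := h (-z)
    rw [mFourierCoeff, neg_neg] at hz
    exact hz
  exact hle hmem

/-- An integrable function on the torus is determined by its Fourier coefficients. -/
theorem ae_eq_zero_of_mFourierCoeff_eq_zero (hf : Integrable f)
    (h : ∀ z, mFourierCoeff f z = 0) : f =ᵐ[volume] 0 := by
  refine ae_eq_zero_of_forall_setIntegral_isClosed_eq_zero hf fun s hs => ?_
  -- The indicator of a closed set is a pointwise limit of continuous functions bounded by 1, so ‖f‖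
  -- dominates.
  have hlim : Filter.Tendsto (fun n => ∫ t, ((hs.apprSeq n t : ℝ) : ℂ) * f t) Filter.atTop
      (nhds (∫ t, s.indicator (fun _ => (1 : ℂ)) t * f t)) := by
    refine tendsto_integral_of_dominated_convergence (fun t => ‖f t‖) (fun n => ?_) hf.norm
      (fun n => .of_forall fun t => ?_) (.of_forall fun t => ?_)
    · exact (Continuous.aestronglyMeasurable (by fun_prop)).mul hf.aestronglyMeasurable
    · rw [norm_mul]
      refine mul_le_of_le_one_left (norm_nonneg _) ?_
      simpa using HasOuterApproxClosed.apprSeq_apply_le_one hs n t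
    · refine Filter.Tendsto.mul_const _ ?_
      have h1 := tendsto_pi_nhds.1 (HasOuterApproxClosed.tendsto_apprSeq hs) t
      by_cases ht : t ∈ s
      · simp only [ht, Set.indicator_of_mem] at h1 ⊢
        exact_mod_cast (Complex.continuous_ofReal.tendsto _).comp
          ((NNReal.continuous_coe.tendsto _).comp h1)
      · simp only [ht, not_false_eq_true, Set.indicator_of_notMem] at h1 ⊢
        exact_mod_cast (Complex.continuous_ofReal.tendsto _).comp
          ((NNReal.continuous_coe.tendsto _).comp h1)
  have hz (n : ℕ) : ∫ t, ((hs.apprSeq n t : ℝ) : ℂ) * f t = 0 :=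
    integral_continuousMap_mul_eq_zero hf h
      ⟨fun t => ((hs.apprSeq n t : ℝ) : ℂ), by fun_prop⟩
  simp only [hz] at hlim
  have := tendsto_nhds_unique hlim tendsto_const_nhds
  rw [← integral_indicator hs.measurableSet, ← this]
  congr 1 with t
  by_cases ht : t ∈ s <;> simp [ht]

/-- An integrable function with square-summable Fourier coefficients is square-integrable. -/
theorem exists_ae_eq_Lp_of_memℓp_mFourierCoeff (hf : Integrable f)
    (h : Memℓp (mFourierCoeff f) 2) :
    ∃ F : Lp ℂ 2 (volume : Measure (UnitAddTorus ι)), f =ᵐ[volume] F := by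
  -- Riesz–Fischer produces an L² function with these coefficients; uniqueness in L¹ then identifies
  -- it with f.
  set F := mFourierBasis.repr.symm (⟨mFourierCoeff f, h⟩ : lp (fun _ : ι → ℤ => ℂ) 2) with hF
  have hcoeff (z : ι → ℤ) : mFourierCoeff F z = mFourierCoeff f z := by
    rw [← mFourierBasis_repr, hF, LinearIsometryEquiv.apply_symm_apply]
  have hFi : Integrable F := (Lp.memLp F).integrable (by norm_num)
  refine ⟨F, ?_⟩
  have := ae_eq_zero_of_mFourierCoeff_eq_zero (hf.sub hFi) fun z => by
    rw [mFourierCoeff_sub hf hFi, hcoeff, sub_self]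
  filter_upwards [this] with t ht
  exact sub_eq_zero.1 ht

theorem hasSum_conj_mFourierCoeff_mul (hf : Integrable f) (hg : Integrable g)
    (hf2 : Memℓp (mFourierCoeff f) 2) (hg2 : Memℓp (mFourierCoeff g) 2) :
    HasSum (fun z => conj (mFourierCoeff f z) * mFourierCoeff g z)
      (∫ t, conj (f t) * g t) := by
  obtain ⟨F, hF⟩ := exists_ae_eq_Lp_of_memℓp_mFourierCoeff hf hf2
  obtain ⟨G, hG⟩ := exists_ae_eq_Lp_of_memℓp_mFourierCoeff hg hg2
  have hF' : mFourierCoeff f = mFourierCoeff F := by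
    ext z; exact integral_congr_ae (hF.mono fun t ht => by simp only [ht])
  have hG' : mFourierCoeff g = mFourierCoeff G := by
    ext z; exact integral_congr_ae (hG.mono fun t ht => by simp only [ht])
  rw [hF', hG', integral_congr_ae (g := fun t => conj (F t) * G t)
    (by filter_upwards [hF, hG] with t h1 h2; rw [h1, h2])]
  exact hasSum_prod_mFourierCoeff F G

end UnitAddTorus
end Torus

namespace QuasiAffine
-- Unfolding ℝᵈ as torus × lattice, and periodization
section Unfolding

open scoped ComplexConjugate
open UnitAddTorus
attribute [local instance] instMeasureSpaceUnitAddCircle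
attribute [local instance] isProbabilityMeasure_volume_unitAddCircle
variable {d : ℕ}

/-- The point of `(0, 1]ᵈ + k` that represents `t ∈ ℝᵈ / ℤᵈ`. -/
noncomputable def torusLift (p : UnitAddTorus (Fin d) × (Fin d → ℤ)) : EuclideanSpace ℝ (Fin d) :=
  WithLp.toLp 2 (measurableEquivPiIoc (0 : Fin d → ℝ) p.1).1 + latticePt p.2

theorem torusLift_add (t : UnitAddTorus (Fin d)) (k l : Fin d → ℤ) :
    torusLift (t, k) + latticePt l = torusLift (t, k + l) := by
  ext i
  simp [torusLift, latticePt, add_assoc]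

theorem coe_torusLift (t : UnitAddTorus (Fin d)) (k : Fin d → ℤ) (i : Fin d) :
    ((torusLift (t, k) i : ℝ) : UnitAddCircle) = t i := by
  have h := congrFun ((measurableEquivPiIoc (0 : Fin d → ℝ)).symm_apply_apply t) i
  rw [coe_symm_measurableEquivPiIoc_apply] at h
  simp only [torusLift, latticePt, PiLp.add_apply, AddCircle.coe_add]
  refine (congrArg (· + _) h).trans ?_
  have : (((k i : ℤ) : ℝ) : UnitAddCircle) = 0 := by
    simp
  rw [this, add_zero]

theorem inner_latticePt (z : Fin d → ℤ) (x : EuclideanSpace ℝ (Fin d)) :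
    inner ℝ (latticePt z) x = ∑ i, z i * x i := by
  simp [latticePt, PiLp.inner_apply, mul_comm]

/-- Coordinates of the lift are representatives modulo 1 and z is integral, so the character ignores
k. -/
theorem fourierChar_torusLift (t : UnitAddTorus (Fin d)) (k z : Fin d → ℤ) :
    (Real.fourierChar (inner ℝ (latticePt z) (torusLift (t, k))) : ℂ) = mFourier z t := by
  have h : mFourier z t = ∏ i, fourier (z i) (t i) := rfl
  rw [h, inner_latticePt, Real.fourierChar_apply]
  simp only [← coe_torusLift t k, fourier_coe_apply]
  rw [← Complex.exp_sum]
  congr 1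
  push_cast
  rw [Finset.mul_sum, Finset.sum_mul]
  exact Finset.sum_congr rfl fun i _ => by ring

theorem measurable_torusLift : Measurable (torusLift (d := d)) := by
  refine Measurable.add ?_ ?_
  · exact (WithLp.measurable_toLp 2 _).comp
      (measurable_subtype_coe.comp ((measurableEquivPiIoc _).measurable.comp measurable_fst))
  · exact (measurable_of_countable latticePt).comp measurable_snd

/-- Each slice at k is carried onto the cube (0, 1]ᵈ + k preserving measure, and these cubes tile
ℝᵈ. -/
theorem measurePreserving_torusLift :
    MeasurePreserving (torusLift (d := d)) (volume.prod Measure.count) volume := by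
  refine ⟨measurable_torusLift, ?_⟩
  ext S hS
  rw [Measure.map_apply measurable_torusLift hS,
    Measure.prod_apply_symm (measurable_torusLift hS), lintegral_count]
  let Q : Set (Fin d → ℝ) := {x | ∀ i, x i ∈ Set.Ioc ((0 : Fin d → ℝ) i) ((0 : Fin d → ℝ) i + 1)}
  have hQ : MeasurableSet Q := MeasurableSet.univ_pi' fun i => measurableSet_Ioc
  let S' : Set (Fin d → ℝ) := WithLp.toLp 2 ⁻¹' S
  have hS' : MeasurableSet S' := WithLp.measurable_toLp 2 _ hS
  let c : (Fin d → ℤ) → Fin d → ℝ := fun k i => k i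
  let R : (Fin d → ℤ) → Set (Fin d → ℝ) := fun k => {x | x - c k ∈ Q} ∩ S'
  have hRm (k) : MeasurableSet (R k) := (measurable_sub_const (c k) hQ).inter hS'
  have hk (k : Fin d → ℤ) :
      volume ((fun t => (t, k)) ⁻¹' (torusLift ⁻¹' S)) = volume (R k) := by
    have h1 : (fun t => (t, k)) ⁻¹' (torusLift ⁻¹' S) =
        measurableEquivPiIoc (0 : Fin d → ℝ) ⁻¹' (Subtype.val ⁻¹' {x | x + c k ∈ S'}) := rfl
    rw [h1, (measurePreserving_equivPiIoc (0 : Fin d → ℝ)).measure_preimage_equiv]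
    refine (comap_subtype_coe_apply (s := Q) hQ _ _).trans ?_
    refine (congrArg volume (Subtype.image_preimage_coe Q {x | x + c k ∈ S'})).trans ?_
    rw [← measure_preimage_add_right volume (c k) (R k)]
    congr 1
    ext x
    simp [R, Q]
  simp only [hk]
  rw [← measure_iUnion _ hRm]
  · rw [← (PiLp.volume_preserving_toLp (Fin d)).measure_preimage hS.nullMeasurableSet]
    congr 1
    ext x
    simp only [R, Set.mem_iUnion, Set.mem_inter_iff, exists_and_right]
    -- The cubes are open on the left, so the index is ⌈x⌉ - 1 rather than ⌊x⌋.
    refine and_iff_right ⟨fun i => ⌈x i⌉ - 1, fun i => ?_⟩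
    simp only [c, Pi.sub_apply, Pi.zero_apply, Int.cast_sub, Int.cast_one]
    constructor <;> linarith [Int.ceil_lt_add_one (x i), Int.le_ceil (x i)]
  · intro k l hkl
    refine Set.disjoint_left.2 fun x hx hx' => hkl (funext fun i => ?_)
    have h1 := hx.1 i
    have h2 := hx'.1 i
    simp only [c, Pi.sub_apply, Pi.zero_apply, Set.mem_Ioc] at h1 h2
    have h3 : k i < l i + 1 := by exact_mod_cast (by linarith : (k i : ℝ) < l i + 1)
    have h4 : l i < k i + 1 := by exact_mod_cast (by linarith : (l i : ℝ) < k i + 1)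
    omega

variable {K : EuclideanSpace ℝ (Fin d) → ℂ}

theorem integrable_comp_torusLift (hK : Integrable K) :
    Integrable (K ∘ torusLift) (volume.prod Measure.count) :=
  (measurePreserving_torusLift.integrable_comp hK.aestronglyMeasurable).2 hK

/-- The periodization of `K` as a function on the torus. -/
noncomputable def torusSum (K : EuclideanSpace ℝ (Fin d) → ℂ) (t : UnitAddTorus (Fin d)) : ℂ :=
  ∑' k, K (torusLift (t, k))

theorem ae_summable_torusLift (hK : Integrable K) :
    ∀ᵐ t, Summable fun k => K (torusLift (t, k)) := by
  filter_upwards [(integrable_comp_torusLift hK).prod_right_ae] with t ht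
  exact (integrable_count_iff.1 ht).of_norm

theorem torusSum_ae_eq (hK : Integrable K) :
    (fun t => ∫ k, K (torusLift (t, k)) ∂Measure.count) =ᵐ[volume] torusSum K := by
  filter_upwards [(integrable_comp_torusLift hK).prod_right_ae] with t ht
  exact (integral_countable ht).trans (by simp [torusSum])

theorem integrable_torusSum (hK : Integrable K) : Integrable (torusSum K) :=
  (integrable_comp_torusLift hK).integral_prod_left.congr (torusSum_ae_eq hK)

theorem integral_torusSum (hK : Integrable K) : ∫ t, torusSum K t = ∫ x, K x := by
  rw [← measurePreserving_torusLift.map_eq, integral_map measurable_torusLift.aemeasurable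
    (by rw [measurePreserving_torusLift.map_eq]; exact hK.aestronglyMeasurable),
    integral_prod (fun p => K (torusLift p)) (integrable_comp_torusLift hK)]
  exact integral_congr_ae (torusSum_ae_eq hK).symm

theorem integrable_fourierChar_mul (hK : Integrable K) (v : EuclideanSpace ℝ (Fin d)) :
    Integrable fun x => (Real.fourierChar (inner ℝ v x) : ℂ) * K x := by
  refine hK.bdd_mul (c := 1) ?_ (.of_forall fun x => (Circle.norm_coe _).le)
  have := Real.continuous_fourierChar
  exact Continuous.aestronglyMeasurable (by fun_prop)

/-- The Fourier coefficients of the periodization of `K` are the values of the Fourier transform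
of `K` on the lattice. -/
theorem mFourierCoeff_torusSum (hK : Integrable K) (z : Fin d → ℤ) :
    mFourierCoeff (torusSum K) (-z) =
      ∫ x, (Real.fourierChar (inner ℝ (latticePt z) x) : ℂ) * K x := by
  rw [← integral_torusSum (integrable_fourierChar_mul hK _), mFourierCoeff]
  simp only [torusSum, fourierChar_torusLift, tsum_mul_left, neg_neg, smul_eq_mul]

theorem ae_torusLift {p : EuclideanSpace ℝ (Fin d) → Prop} (hp : ∀ᵐ x, p x) :
    ∀ᵐ t, ∀ k, p (torusLift (t, k)) := by
  have h := Measure.ae_ae_of_ae_prod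
    (measurePreserving_torusLift.quasiMeasurePreserving.ae hp)
  filter_upwards [h] with t ht k
  exact Measure.ae_count_iff.1 ht k

theorem ae_of_ae_torusLift {p : EuclideanSpace ℝ (Fin d) → Prop} (hm : MeasurableSet {x | p x})
    (hp : ∀ᵐ t, ∀ k, p (torusLift (t, k))) : ∀ᵐ x, p x := by
  rw [← measurePreserving_torusLift.map_eq,
    ae_map_iff measurable_torusLift.aemeasurable hm]
  refine (Measure.ae_prod_iff_ae_ae (measurable_torusLift hm)).2 ?_
  filter_upwards [hp] with t ht
  exact .of_forall ht

end Unfolding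

/-! ### Translations and dilations under the Fourier–Plancherel transform -/

section FourierOperators

open scoped ComplexConjugate
variable {d : ℕ}

theorem act_mul (M N : Matrix (Fin d) (Fin d) ℝ) (x : EuclideanSpace ℝ (Fin d)) :
    act (M * N) x = act M (act N x) := by
  ext i
  simp [act, Matrix.toLpLin_apply]

theorem act_one (x : EuclideanSpace ℝ (Fin d)) : act 1 x = x := by
  ext i
  simp [act]

theorem inner_act (M : Matrix (Fin d) (Fin d) ℝ) (x y : EuclideanSpace ℝ (Fin d)) :
    inner ℝ (act M x) y = inner ℝ x (act Mᵀ y) := by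
  simp [act, Matrix.toLpLin_apply, EuclideanSpace.inner_eq_star_dotProduct,
    Matrix.dotProduct_mulVec, Matrix.vecMul_transpose, dotProduct_comm]

/-- The transpose of an invertible matrix. -/
noncomputable def transposeGL (M : GL (Fin d) ℝ) : GL (Fin d) ℝ where
  val := (M : Matrix (Fin d) (Fin d) ℝ)ᵀ
  inv := ((M⁻¹ : GL (Fin d) ℝ) : Matrix (Fin d) (Fin d) ℝ)ᵀ
  val_inv := by rw [← Matrix.transpose_mul, Units.inv_mul, Matrix.transpose_one]
  inv_val := by rw [← Matrix.transpose_mul, Units.mul_inv, Matrix.transpose_one]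

theorem det_toEuclideanLin (M : Matrix (Fin d) (Fin d) ℝ) :
    LinearMap.det (Matrix.toEuclideanLin M) = M.det := by
  change LinearMap.det (Matrix.toLpLin 2 2 M) = _
  rw [Matrix.toLpLin_eq_toLin, LinearMap.det_toLin]

theorem det_coe_ne_zero (M : GL (Fin d) ℝ) : (M : Matrix (Fin d) (Fin d) ℝ).det ≠ 0 :=
  (M.isUnit.map Matrix.detMonoidHom).ne_zero

theorem continuous_act (M : Matrix (Fin d) (Fin d) ℝ) : Continuous (act M) :=
  LinearMap.continuous_of_finiteDimensional (Matrix.toEuclideanLin M)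

theorem act_inv_act (M : GL (Fin d) ℝ) (x : EuclideanSpace ℝ (Fin d)) :
    act (M⁻¹ : GL (Fin d) ℝ) (act M x) = x := by
  rw [← act_mul, Units.inv_mul, act_one]

theorem act_act_inv (M : GL (Fin d) ℝ) (x : EuclideanSpace ℝ (Fin d)) :
    act M (act (M⁻¹ : GL (Fin d) ℝ) x) = x := by
  rw [← act_mul, Units.mul_inv, act_one]

theorem map_act_volume (M : GL (Fin d) ℝ) :
    Measure.map (act M) volume =
      ENNReal.ofReal |(M : Matrix (Fin d) (Fin d) ℝ).det|⁻¹ •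
        (volume : Measure (EuclideanSpace ℝ (Fin d))) := by
  have h := Measure.map_linearMap_addHaar_eq_smul_addHaar
    (volume : Measure (EuclideanSpace ℝ (Fin d))) (det_toEuclideanLin_ne_zero M)
  rw [det_toEuclideanLin, abs_inv] at h
  exact h

theorem quasiMeasurePreserving_act (M : GL (Fin d) ℝ) :
    Measure.QuasiMeasurePreserving (act (M : Matrix (Fin d) (Fin d) ℝ)) := by
  refine ⟨(continuous_act _).measurable, ?_⟩
  rw [map_act_volume]
  exact Measure.smul_absolutelyContinuous

/-- The homeomorphism of `ℝᵈ` given by an invertible matrix. -/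
noncomputable def actHomeomorph (M : GL (Fin d) ℝ) :
    EuclideanSpace ℝ (Fin d) ≃ₜ EuclideanSpace ℝ (Fin d) where
  toFun := act M
  invFun := act (M⁻¹ : GL (Fin d) ℝ)
  left_inv := act_inv_act M
  right_inv := act_act_inv M
  continuous_toFun := continuous_act _
  continuous_invFun := continuous_act _

theorem integral_comp_act (M : GL (Fin d) ℝ) (g : EuclideanSpace ℝ (Fin d) → ℂ) :
    ∫ x, g (act M x) = (|(M : Matrix (Fin d) (Fin d) ℝ).det|⁻¹ : ℝ) • ∫ x, g x := by
  have h := (actHomeomorph M).measurableEmbedding.integral_map (μ := volume) g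
  change ∫ y, g y ∂(Measure.map (act M) volume) = ∫ x, g (act M x) at h
  rw [← h, map_act_volume, integral_smul_measure, ENNReal.toReal_ofReal (by positivity)]

theorem coeFn_compAct (M : GL (Fin d) ℝ) (f : L2 d) :
    compAct M f =ᵐ[volume] fun x => f (act M x) :=
  (memLp_comp_act M f).coeFn_toLp

theorem coeFn_translation (α : EuclideanSpace ℝ (Fin d)) (f : L2 d) :
    translation α f =ᵐ[volume] fun x => f (x - α) :=
  Lp.coeFn_compMeasurePreserving f (measurePreserving_sub_right volume α)

theorem continuous_translation (α : EuclideanSpace ℝ (Fin d)) :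
    Continuous (translation (d := d) α) :=
  (Lp.isometry_compMeasurePreserving (measurePreserving_sub_right volume α)).continuous

theorem norm_compAct (M : GL (Fin d) ℝ) (f : L2 d) :
    ‖compAct M f‖ = √(|(M : Matrix (Fin d) (Fin d) ℝ).det|⁻¹) * ‖f‖ := by
  have h : eLpNorm (fun x => f (act M x)) 2 volume = eLpNorm f 2 (Measure.map (act M) volume) :=
    ((actHomeomorph M).measurableEmbedding.eLpNorm_map_measure (g := f) ).symm
  rw [compAct, Lp.norm_toLp, h, map_act_volume, eLpNorm_smul_measure_of_ne_top (by norm_num)]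
  simp only [Lp.norm_def, smul_eq_mul, ENNReal.toReal_mul, ← ENNReal.toReal_rpow,
    ENNReal.toReal_ofReal (inv_nonneg.2 (abs_nonneg _)), Real.sqrt_eq_rpow]
  norm_num

theorem compAct_sub (M : GL (Fin d) ℝ) (f g : L2 d) :
    compAct M (f - g) = compAct M f - compAct M g := by
  ext1
  filter_upwards [coeFn_compAct M (f - g), coeFn_compAct M f, coeFn_compAct M g,
    Lp.coeFn_sub (compAct M f) (compAct M g),
    (quasiMeasurePreserving_act M).ae (Lp.coeFn_sub f g)] with x h1 h2 h3 h4 h5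
  rw [h1, h4, Pi.sub_apply, h2, h3, h5, Pi.sub_apply]

theorem continuous_compAct (M : GL (Fin d) ℝ) : Continuous (compAct (d := d) M) := by
  refine LipschitzWith.continuous (K := (√(|(M : Matrix (Fin d) (Fin d) ℝ).det|⁻¹)).toNNReal)
    (LipschitzWith.of_dist_le_mul fun f g => ?_)
  rw [dist_eq_norm, dist_eq_norm, ← compAct_sub, norm_compAct,
    Real.coe_toNNReal _ (Real.sqrt_nonneg _)]

theorem compAct_inv_compAct (M : GL (Fin d) ℝ) (f : L2 d) : compAct M⁻¹ (compAct M f) = f := by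
  ext1
  filter_upwards [coeFn_compAct M⁻¹ (compAct M f),
    (quasiMeasurePreserving_act M⁻¹).ae (coeFn_compAct M f)] with x h1 h2
  rw [h1, h2, act_act_inv]

theorem memLp_fourierChar_mul (α : EuclideanSpace ℝ (Fin d)) (f : L2 d) :
    MemLp (fun x => (Real.fourierChar (-inner ℝ α x) : ℂ) * f x) 2 volume := by
  refine (Lp.memLp f).of_le ?_ (.of_forall fun x => ?_)
  · have := Real.continuous_fourierChar
    exact (Continuous.aestronglyMeasurable (by fun_prop)).mul (Lp.aestronglyMeasurable f)
  · rw [norm_mul, Circle.norm_coe, one_mul]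

/-- The modulation operator `f ↦ exp (-2πi⟨α, ·⟩) f`. -/
noncomputable def modulation (α : EuclideanSpace ℝ (Fin d)) (f : L2 d) : L2 d :=
  (memLp_fourierChar_mul α f).toLp

theorem coeFn_modulation (α : EuclideanSpace ℝ (Fin d)) (f : L2 d) :
    modulation α f =ᵐ[volume] fun x => (Real.fourierChar (-inner ℝ α x) : ℂ) * f x :=
  (memLp_fourierChar_mul α f).coeFn_toLp

theorem continuous_modulation (α : EuclideanSpace ℝ (Fin d)) :
    Continuous (modulation (d := d) α) := by
  refine (LipschitzWith.of_dist_le_mul (K := 1) fun f g => ?_).continuous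
  rw [dist_eq_norm, dist_eq_norm, NNReal.coe_one, one_mul]
  refine Lp.norm_le_norm_of_ae_le ?_
  filter_upwards [coeFn_modulation α f, coeFn_modulation α g, Lp.coeFn_sub f g,
    Lp.coeFn_sub (modulation α f) (modulation α g)] with x h1 h2 h3 h4
  rw [h3, h4, Pi.sub_apply, Pi.sub_apply, h1, h2, ← mul_sub, norm_mul, Circle.norm_coe, one_mul]

/-- Both sides are continuous in f, so it suffices to check Schwartz functions, where the integral
formula applies. The dilation rule below is obtained in the same way. -/
theorem fourier_translation (α : EuclideanSpace ℝ (Fin d)) (f : L2 d) :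
    (𝓕 (translation α f) : L2 d) = modulation α (𝓕 f) := by
  have hF : Continuous (𝓕 : L2 d → L2 d) := (Lp.fourierTransformₗᵢ _ ℂ).continuous
  refine congrFun ((SchwartzMap.denseRange_toLpCLM (F := ℂ) (μ := volume)
    (E := EuclideanSpace ℝ (Fin d)) (p := 2) ENNReal.ofNat_ne_top).equalizer
    (g := fun f : L2 d => (𝓕 (translation α f) : L2 d)) (h := fun f => modulation α (𝓕 f))
    (hF.comp (continuous_translation α)) ((continuous_modulation α).comp hF) ?_) f
  ext1 φ
  simp only [Function.comp_apply, SchwartzMap.toLpCLM_apply]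
  have h1 : translation α (φ.toLp 2) = (φ.compSubConstCLM ℂ α).toLp 2 := by
    ext1
    filter_upwards [coeFn_translation α (φ.toLp 2), (φ.compSubConstCLM ℂ α).coeFn_toLp 2,
      (measurePreserving_sub_right volume α).quasiMeasurePreserving.ae
        (φ.coeFn_toLp 2 volume)]
      with x h1 h2 h3
    rw [h1, h2, h3, SchwartzMap.compSubConstCLM_apply]
  rw [h1, SchwartzMap.toLp_fourier_eq, SchwartzMap.toLp_fourier_eq]
  ext1
  filter_upwards [(𝓕 (φ.compSubConstCLM ℂ α)).coeFn_toLp 2, coeFn_modulation α ((𝓕 φ).toLp 2),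
    (𝓕 φ).coeFn_toLp 2] with x h2 h3 h4
  rw [h2, h3, h4, SchwartzMap.fourier_coe, SchwartzMap.fourier_coe]
  have := congrFun (VectorFourier.fourierIntegral_comp_add_right Real.fourierChar volume
    (innerₗ (EuclideanSpace ℝ (Fin d))) φ (-α)) x
  simpa [Circle.smul_def, sub_eq_add_neg] using! this

theorem fourier_compAct (M : GL (Fin d) ℝ) (f : L2 d) :
    (𝓕 (compAct M f) : L2 d) = ((|(M : Matrix (Fin d) (Fin d) ℝ).det|⁻¹ : ℝ) : ℂ) •
      compAct (transposeGL M)⁻¹ (𝓕 f) := by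
  have hF : Continuous (𝓕 : L2 d → L2 d) := (Lp.fourierTransformₗᵢ _ ℂ).continuous
  refine congrFun ((SchwartzMap.denseRange_toLpCLM (F := ℂ) (μ := volume)
    (E := EuclideanSpace ℝ (Fin d)) (p := 2) ENNReal.ofNat_ne_top).equalizer
    (g := fun f : L2 d => (𝓕 (compAct M f) : L2 d))
    (h := fun f => ((|(M : Matrix (Fin d) (Fin d) ℝ).det|⁻¹ : ℝ) : ℂ) •
      compAct (transposeGL M)⁻¹ (𝓕 f))
    (hF.comp (continuous_compAct M))
    (((continuous_compAct (transposeGL M)⁻¹).comp hF).const_smul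
      ((|(M : Matrix (Fin d) (Fin d) ℝ).det|⁻¹ : ℝ) : ℂ)) ?_) f
  ext1 φ
  simp only [Function.comp_apply, SchwartzMap.toLpCLM_apply]
  let e : EuclideanSpace ℝ (Fin d) ≃L[ℝ] EuclideanSpace ℝ (Fin d) :=
    { Matrix.toEuclideanLin (M : Matrix (Fin d) (Fin d) ℝ), actHomeomorph M with }
  have h1 : compAct M (φ.toLp 2) = (SchwartzMap.compCLMOfContinuousLinearEquiv ℂ e φ).toLp 2 := by
    ext1
    filter_upwards [coeFn_compAct M (φ.toLp 2),
      (SchwartzMap.compCLMOfContinuousLinearEquiv ℂ e φ).coeFn_toLp 2,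
      (quasiMeasurePreserving_act M).ae (φ.coeFn_toLp 2 volume)] with x h1 h2 h3
    rw [h1, h2, h3, SchwartzMap.compCLMOfContinuousLinearEquiv_apply]
    rfl
  rw [h1, SchwartzMap.toLp_fourier_eq, SchwartzMap.toLp_fourier_eq]
  ext1
  filter_upwards [(𝓕 (SchwartzMap.compCLMOfContinuousLinearEquiv ℂ e φ)).coeFn_toLp 2,
    Lp.coeFn_smul ((|(M : Matrix (Fin d) (Fin d) ℝ).det|⁻¹ : ℝ) : ℂ)
      (compAct (transposeGL M)⁻¹ ((𝓕 φ).toLp 2)),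
    coeFn_compAct (transposeGL M)⁻¹ ((𝓕 φ).toLp 2),
    (quasiMeasurePreserving_act (transposeGL M)⁻¹).ae ((𝓕 φ).coeFn_toLp 2 volume)] with x h2 h3 h4 h5
  rw [h2, h3, Pi.smul_apply, h4, h5, SchwartzMap.fourier_coe, SchwartzMap.fourier_coe,
    Real.fourier_eq, Real.fourier_eq]
  have h6 := integral_comp_act M fun v =>
    Real.fourierChar (-inner ℝ v (act ((transposeGL M)⁻¹ : GL (Fin d) ℝ) x)) • φ v
  rw [Complex.real_smul] at h6
  rw [smul_eq_mul, ← h6]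
  congr 1 with v
  have h7 : inner ℝ (act M v) (act ((transposeGL M)⁻¹ : GL (Fin d) ℝ) x) = inner ℝ v x := by
    rw [inner_act]
    exact congrArg (inner ℝ v) (act_act_inv (transposeGL M) x)
  rw [h7]
  rfl

end FourierOperators

/-! ### Frame coefficients as Fourier coefficients, and the support sets -/

section System

open scoped ComplexConjugate
open UnitAddTorus
attribute [local instance] instMeasureSpaceUnitAddCircle
attribute [local instance] isProbabilityMeasure_volume_unitAddCircle
variable {d n : ℕ}

/-- The matrix `A^{*-r} X^{*-1}` as an invertible matrix. -/
noncomputable def symbolMatrix (A X : GL (Fin d) ℝ) (r : ℤ) : GL (Fin d) ℝ :=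
  transposeGL A ^ (-r) * (transposeGL X)⁻¹

theorem coe_symbolMatrix (A X : GL (Fin d) ℝ) (r : ℤ) :
    (symbolMatrix A X r : Matrix (Fin d) (Fin d) ℝ) =
      (A : Matrix (Fin d) (Fin d) ℝ)ᵀ ^ (-r) * ((X : Matrix (Fin d) (Fin d) ℝ)ᵀ)⁻¹ := by
  rw [symbolMatrix, Units.val_mul, Matrix.coe_units_zpow, Matrix.coe_units_inv]
  rfl

/-- The function `ψ̂(A^{*-r} X^{*-1} ·)`. -/
noncomputable def symbol (A X : GL (Fin d) ℝ) (ψ : L2 d) (r : ℤ) : L2 d :=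
  compAct (symbolMatrix A X r) (𝓕 ψ)

theorem transposeGL_zpow (A : GL (Fin d) ℝ) (m : ℤ) :
    transposeGL (A ^ m) = transposeGL A ^ m := by
  ext1
  simp [transposeGL, Matrix.coe_units_zpow, Matrix.transpose_zpow]

/-- On the Fourier side the entries of a quasi-affine system are modulations of the symbol. -/
theorem exists_fourier_quasiAffineSystem_ae_eq (A X : GL (Fin d) ℝ) (ψ : Fin n → L2 d)
    (j : Fin n) (m : ℤ) :
    ∃ (N : GL (Fin d) ℝ) (c : ℂ), c ≠ 0 ∧ ∀ z : Fin d → ℤ,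
      (𝓕 (quasiAffineSystem A X ψ (j, m, z)) : L2 d) =ᵐ[volume] fun ξ =>
        c * ((Real.fourierChar (-inner ℝ (latticePt z) (act N ξ)) : ℂ) *
          symbol A X (ψ j) (min m 0) (act N ξ)) := by
  have hdet := abs_pos.2 (det_coe_ne_zero (A ^ m))
  rcases le_or_gt 0 m with hm | hm
  -- For m ≥ 0 the dilation acts last and rescales the modulation together with ψ̂, so it is
  -- absorbed into N; only the level-0 symbol remains.
  · refine ⟨transposeGL X * (transposeGL (A ^ m))⁻¹,
      (√|((A ^ m : GL (Fin d) ℝ) : Matrix (Fin d) (Fin d) ℝ).det| : ℝ) *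
      (|((A ^ m : GL (Fin d) ℝ) : Matrix (Fin d) (Fin d) ℝ).det|⁻¹ : ℝ), ?_, fun z => ?_⟩
    · exact mul_ne_zero (by exact_mod_cast (Real.sqrt_pos.2 hdet).ne')
        (by exact_mod_cast (inv_pos.2 hdet).ne')
    rw [quasiAffineSystem, if_pos hm, dilation, FourierTransform.fourier_smul, fourier_compAct,
      fourier_translation, smul_smul, min_eq_right hm]
    filter_upwards [Lp.coeFn_smul
        (((√|((A ^ m : GL (Fin d) ℝ) : Matrix (Fin d) (Fin d) ℝ).det| : ℝ) : ℂ) *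
          ((|((A ^ m : GL (Fin d) ℝ) : Matrix (Fin d) (Fin d) ℝ).det|⁻¹ : ℝ) : ℂ))
        (compAct (transposeGL (A ^ m))⁻¹
          (modulation (act X (latticePt z)) (𝓕 (ψ j)))),
      coeFn_compAct (transposeGL (A ^ m))⁻¹ (modulation (act X (latticePt z)) (𝓕 (ψ j))),
      (quasiMeasurePreserving_act (transposeGL (A ^ m))⁻¹).ae
        (coeFn_modulation (act X (latticePt z)) (𝓕 (ψ j))),
      (quasiMeasurePreserving_act (transposeGL X * (transposeGL (A ^ m))⁻¹)).ae
        (coeFn_compAct (symbolMatrix A X 0) (𝓕 (ψ j)))] with ξ h1 h2 h3 h4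
    rw [h1, Pi.smul_apply, h2, h3, symbol, h4, smul_eq_mul, inner_act]
    congr 3
    · rw [Units.val_mul, act_mul]; rfl
    · rw [← act_mul, ← Units.val_mul, symbolMatrix]
      congr 2
      simp
  -- For m < 0 the factor |det| of the L¹-normalized dilation cancels the Jacobian, and the dilation
  -- stays in the symbol.
  · refine ⟨transposeGL X, 1, one_ne_zero, fun z => ?_⟩
    rw [quasiAffineSystem, if_neg hm.not_ge, dilationL1, fourier_translation,
      FourierTransform.fourier_smul, fourier_compAct, smul_smul, min_eq_left hm.le,
      ← Complex.ofReal_mul, mul_inv_cancel₀ hdet.ne', Complex.ofReal_one, one_smul]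
    filter_upwards [coeFn_modulation (act X (latticePt z))
        (compAct (transposeGL (A ^ m))⁻¹ (𝓕 (ψ j))),
      coeFn_compAct (transposeGL (A ^ m))⁻¹ (𝓕 (ψ j)),
      (quasiMeasurePreserving_act (transposeGL X)).ae
        (coeFn_compAct (symbolMatrix A X m) (𝓕 (ψ j)))] with ξ h1 h2 h3
    rw [h1, h2, symbol, h3, one_mul, inner_act]
    congr 2
    rw [← act_mul, ← Units.val_mul, symbolMatrix, transposeGL_zpow]
    congr 2
    simp

theorem integrable_conj_mul (h g : L2 d) : Integrable fun η => conj (h η) * g η := by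
  simpa [RCLike.inner_apply, mul_comm] using L2.integrable_inner (𝕜 := ℂ) h g

/-- The frame coefficients at a fixed level are, up to a constant, the Fourier coefficients of a
periodization. -/
theorem exists_inner_quasiAffineSystem_eq (A X : GL (Fin d) ℝ) (ψ : Fin n → L2 d)
    (j : Fin n) (m : ℤ) :
    ∃ (S : L2 d → L2 d) (c : ℂ), Function.Surjective S ∧ c ≠ 0 ∧ ∀ (z : Fin d → ℤ) (f : L2 d),
      inner ℂ (quasiAffineSystem A X ψ (j, m, z)) f =
        c * mFourierCoeff (torusSum fun η =>
          conj (symbol A X (ψ j) (min m 0) η) * S f η) (-z) := by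
  obtain ⟨N, c, hc, h⟩ := exists_fourier_quasiAffineSystem_ae_eq A X ψ j m
  -- The substitution η = Nξ turns the modulations into lattice characters and yields the factor
  -- |det N|⁻¹.
  refine ⟨fun f => compAct N⁻¹ (𝓕 f),
    conj c * ((|(N : Matrix (Fin d) (Fin d) ℝ).det|⁻¹ : ℝ) : ℂ), fun g => ?_, ?_, fun z f => ?_⟩
  · refine ⟨𝓕⁻ (compAct N g), ?_⟩
    dsimp only
    rw [FourierTransform.fourier_fourierInv_eq, compAct_inv_compAct]
  · refine mul_ne_zero (by simpa using hc) ?_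
    exact_mod_cast (inv_pos.2 (abs_pos.2 (det_coe_ne_zero N))).ne'
  rw [mFourierCoeff_torusSum (integrable_conj_mul _ _), ← Lp.inner_fourier_eq, L2.inner_def,
    mul_assoc, ← Complex.real_smul, ← integral_comp_act N, ← integral_const_mul]
  refine integral_congr_ae ?_
  filter_upwards [h z, (quasiMeasurePreserving_act N).ae (coeFn_compAct N⁻¹ (𝓕 f))] with ξ h1 h2
  rw [h2, act_inv_act, RCLike.inner_apply, h1, map_mul, map_mul, AddChar.map_neg_eq_inv,
    Circle.coe_inv_eq_conj, Complex.conj_conj]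
  ring

theorem memℓp_mFourierCoeff_torusSum {A X : GL (Fin d) ℝ} {ψ : Fin n → L2 d}
    (hψ : IsFrame (quasiAffineSystem A X ψ)) (j : Fin n) (m : ℤ) (f : L2 d) {c : ℂ} (hc : c ≠ 0)
    {p : UnitAddTorus (Fin d) → ℂ} (h : ∀ z : Fin d → ℤ,
      inner ℂ (quasiAffineSystem A X ψ (j, m, z)) f = c * mFourierCoeff p (-z)) :
    Memℓp (mFourierCoeff p) 2 := by
  obtain ⟨_, _, _, _, hs⟩ := hψ
  have h1 : Summable fun z : Fin d → ℤ =>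
      ‖inner ℂ (quasiAffineSystem A X ψ (j, m, z)) f‖ ^ 2 :=
    (hs f).1.comp_injective (i := fun z => (j, m, z)) fun a b hab =>
      congrArg (fun p : Fin n × ℤ × (Fin d → ℤ) => p.2.2) hab
  simp only [h, norm_mul, mul_pow] at h1
  have h2 : Summable fun z => ‖mFourierCoeff p (-z)‖ ^ 2 :=
    (summable_mul_left_iff (pow_ne_zero 2 (norm_ne_zero_iff.2 hc))).1 h1
  have h3 : Summable fun z => ‖mFourierCoeff p z‖ ^ 2 :=
    (Equiv.neg (Fin d → ℤ)).summable_iff (f := fun z => ‖mFourierCoeff p z‖ ^ 2) |>.1 h2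
  refine memℓp_gen ?_
  simpa using h3

/-- `symbol` is an L² class; the agreement with ψ̂ ∘ (matrix) holds at all points of almost every
fibre because a null set of ℝᵈ misses almost every fibre entirely. -/
theorem symbol_torusLift (A X : GL (Fin d) ℝ) (ψ : L2 d) (r : ℤ) :
    ∀ᵐ t, ∀ k k', symbol A X ψ r (torusLift (t, k) + latticePt k') =
      (𝓕 ψ : L2 d) (act ((A : Matrix (Fin d) (Fin d) ℝ)ᵀ ^ (-r) *
        ((X : Matrix (Fin d) (Fin d) ℝ)ᵀ)⁻¹) (torusLift (t, k) + latticePt k')) := by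
  filter_upwards [ae_torusLift (coeFn_compAct (symbolMatrix A X r) (𝓕 ψ))] with t ht k k'
  rw [torusLift_add, ← coe_symbolMatrix]
  exact ht _

/-- Whether a point lies in the support set depends only on its class modulo `ℤᵈ`. -/
theorem ae_torusLift_mem_supportSet_iff (A X : GL (Fin d) ℝ) (ψ : L2 d) (r : ℤ) :
    ∀ᵐ t, ∀ k, torusLift (t, k) ∈ supportSet A X ψ r ↔
      ∃ l, symbol A X ψ r (torusLift (t, l)) ≠ 0 := by
  filter_upwards [symbol_torusLift A X ψ r] with t ht k
  rw [supportSet, Set.mem_ofPred_eq, periodization, ne_eq, ENNReal.tsum_eq_zero, not_forall]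
  simp only [← ht k]
  simp only [torusLift_add, pow_eq_zero_iff two_ne_zero, enorm_eq_zero]
  exact (Equiv.addLeft k).exists_congr_right
    (q := fun l => ¬symbol A X ψ r (torusLift (t, l)) = 0)

theorem measurableSet_supportSet (A X : GL (Fin d) ℝ) (ψ : L2 d) (r : ℤ) :
    MeasurableSet (supportSet A X ψ r) := by
  have h : Measurable (periodization A X ψ r) := by
    refine Measurable.tsum fun k => ?_
    refine Measurable.pow_const (Measurable.enorm ?_) 2
    exact (Lp.stronglyMeasurable _).measurable.comp
      ((continuous_act _).measurable.comp (measurable_add_const _))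
  exact (h (measurableSet_singleton 0)).compl

theorem volume_supportSet_diff_eq_zero {A B X Y : GL (Fin d) ℝ} {ψ φ : Fin n → L2 d}
    (hψ : IsFrame (quasiAffineSystem A X ψ)) (hφ : IsFrame (quasiAffineSystem B Y φ))
    (hle : LinearMap.range (analysisOperator hψ) ≤ LinearMap.range (analysisOperator hφ))
    (j : Fin n) {r : ℤ} (hr : r ≤ 0) :
    volume (supportSet A X (ψ j) r \ supportSet B Y (φ j) r) = 0 := by
  obtain ⟨S, c, hS, hc, h⟩ := exists_inner_quasiAffineSystem_eq A X ψ j r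
  obtain ⟨S', c', -, hc', h'⟩ := exists_inner_quasiAffineSystem_eq B Y φ j r
  rw [min_eq_left hr] at h h'
  -- With this f, K becomes |σ|², whose periodization detects every nonzero value of σ on a fibre.
  obtain ⟨f, hf⟩ := hS (symbol A X (ψ j) r)
  obtain ⟨g, hg⟩ := hle ⟨f, rfl⟩
  set K := fun η => conj (symbol A X (ψ j) r η) * S f η
  set K' := fun η => conj (symbol B Y (φ j) r η) * S' g η
  have hK : Integrable K := integrable_conj_mul _ _
  have hK' : Integrable K' := integrable_conj_mul _ _
  have heq (z : Fin d → ℤ) :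
      c' * mFourierCoeff (torusSum K') (-z) = c * mFourierCoeff (torusSum K) (-z) := by
    rw [← h, ← h']
    exact congrArg (fun u : lp (fun _ : Fin n × ℤ × (Fin d → ℤ) => ℂ) 2 => u (j, r, z)) hg
  have hzero := ae_eq_zero_of_mFourierCoeff_eq_zero
    (((integrable_torusSum hK').const_mul c').sub ((integrable_torusSum hK).const_mul c))
    fun z => by
      rw [mFourierCoeff_sub ((integrable_torusSum hK').const_mul c')
        ((integrable_torusSum hK).const_mul c)]
      have e := heq (-z)
      rw [neg_neg] at e
      simp only [mFourierCoeff, smul_eq_mul, mul_left_comm _ c, mul_left_comm _ c',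
        integral_const_mul] at e ⊢
      rw [e, sub_self]
  rw [measure_eq_zero_iff_ae_notMem]
  refine ae_of_ae_torusLift ((measurableSet_supportSet A X (ψ j) r).diff
    (measurableSet_supportSet B Y (φ j) r)).compl ?_
  filter_upwards [hzero, ae_torusLift_mem_supportSet_iff A X (ψ j) r,
    ae_torusLift_mem_supportSet_iff B Y (φ j) r, ae_summable_torusLift hK]
    with t h0 h1 h2 h3 k hk
  rw [Set.mem_sdiff, h1, h2] at hk
  obtain ⟨⟨l, hl⟩, hk'⟩ := hk
  push Not at hk'
  refine hl ?_
  -- Off the second support set, every term of the periodization of K' is zero.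
  have hs' : torusSum K' t = 0 := by simp [torusSum, K', hk']
  have hs : torusSum K t = 0 := by
    simpa [hs', hc] using h0
  have hKn (k) : K (torusLift (t, k)) =
      ((‖symbol A X (ψ j) r (torusLift (t, k))‖ ^ 2 : ℝ) : ℂ) := by
    simp only [K, hf]
    rw [← Complex.normSq_eq_conj_mul_self, Complex.normSq_eq_norm_sq]
  simp only [torusSum, hKn, ← Complex.ofReal_tsum, Complex.ofReal_eq_zero] at hs
  simp only [hKn] at h3
  -- A vanishing sum of squares forces σ = 0 on the fibre, contradicting `hl`.
  have h4 := (hasSum_zero_iff_of_nonneg fun _ => sq_nonneg _).1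
    (hs ▸ (Complex.summable_ofReal.1 h3).hasSum)
  simpa using congrFun h4 l

theorem range_analysisOperator_isOrtho {A B X Y : GL (Fin d) ℝ} {ψ φ : Fin n → L2 d}
    (hψ : IsFrame (quasiAffineSystem A X ψ)) (hφ : IsFrame (quasiAffineSystem B Y φ))
    (hdisj : ∀ j : Fin n, ∀ r : ℤ, r ≤ 0 →
      volume (supportSet A X (ψ j) r ∩ supportSet B Y (φ j) r) = 0) :
    LinearMap.range (analysisOperator hψ) ⟂ LinearMap.range (analysisOperator hφ) := by
  rw [Submodule.isOrtho_iff_inner_eq]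
  rintro _ ⟨f, rfl⟩ _ ⟨g, rfl⟩
  have hsum (j : Fin n) (m : ℤ) : HasSum (fun z : Fin d → ℤ =>
      inner ℂ (inner ℂ (quasiAffineSystem A X ψ (j, m, z)) f)
        (inner ℂ (quasiAffineSystem B Y φ (j, m, z)) g)) 0 := by
    obtain ⟨S, c, -, hc, h⟩ := exists_inner_quasiAffineSystem_eq A X ψ j m
    obtain ⟨S', c', -, hc', h'⟩ := exists_inner_quasiAffineSystem_eq B Y φ j m
    have hp := hasSum_conj_mFourierCoeff_mul
      (integrable_torusSum (integrable_conj_mul (symbol A X (ψ j) (min m 0)) (S f)))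
      (integrable_torusSum (integrable_conj_mul (symbol B Y (φ j) (min m 0)) (S' g)))
      (memℓp_mFourierCoeff_torusSum hψ j m f hc fun z => h z f)
      (memℓp_mFourierCoeff_torusSum hφ j m g hc' fun z => h' z g)
    have hdj := measure_eq_zero_iff_ae_notMem.1 (hdisj j (min m 0) (min_le_right _ _))
    rw [integral_eq_zero_of_ae] at hp
    · have hp' := ((Equiv.neg (Fin d → ℤ)).hasSum_iff.2 hp).mul_left (conj c * c')
      rw [mul_zero] at hp'
      refine hp'.congr_fun fun z => ?_
      simp only [h, h', RCLike.inner_apply, map_mul, Function.comp_apply, Equiv.neg_apply]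
      ring
    · filter_upwards [ae_torusLift hdj, ae_torusLift_mem_supportSet_iff A X (ψ j) (min m 0),
        ae_torusLift_mem_supportSet_iff B Y (φ j) (min m 0)] with t h0 h1 h2
      -- One fibre point suffices: membership in either support set is constant along the fibre.
      have h3 := h0 0
      rw [Set.mem_inter_iff, h1, h2, not_and_or] at h3
      push Not at h3
      rcases h3 with h3 | h3 <;> simp [torusSum, h3]
  -- Summability of the full ℓ² inner product permits summing level by level, with z innermost.
  have htot := lp.hasSum_inner (𝕜 := ℂ) (analysisOperator hψ f) (analysisOperator hφ g)
  rw [← htot.tsum_eq]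
  rw [htot.summable.tsum_prod]
  refine (tsum_congr fun j => ?_).trans tsum_zero
  rw [(htot.summable.prod_factor j).tsum_prod]
  refine (tsum_congr fun m => ?_).trans tsum_zero
  exact (hsum j m).tsum_eq

end System
end QuasiAffine

open QuasiAffine in
theorem mainTheorem6 {d n : ℕ} (A B X Y : GL (Fin d) ℝ)
    (hA : IsExpansive (A : Matrix (Fin d) (Fin d) ℝ))
    (hB : IsExpansive (B : Matrix (Fin d) (Fin d) ℝ))
    (ψ φ : Fin n → L2 d)
    (hψ : IsFrame (quasiAffineSystem A X ψ)) (hφ : IsFrame (quasiAffineSystem B Y φ)) :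
    (LinearMap.range (analysisOperator hψ) ≤ LinearMap.range (analysisOperator hφ) →
      ∀ j : Fin n, ∀ r : ℤ, r ≤ 0 →
        volume (supportSet A X (ψ j) r \ supportSet B Y (φ j) r) = 0) ∧
    (LinearMap.range (analysisOperator hψ) = LinearMap.range (analysisOperator hφ) →
      ∀ j : Fin n, ∀ r : ℤ, r ≤ 0 →
        volume (symmDiff (supportSet A X (ψ j) r) (supportSet B Y (φ j) r)) = 0) ∧
    ((∀ j : Fin n, ∀ r : ℤ, r ≤ 0 →
        volume (supportSet A X (ψ j) r ∩ supportSet B Y (φ j) r) = 0) →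
      LinearMap.range (analysisOperator hψ) ⟂ LinearMap.range (analysisOperator hφ)) := by
  refine ⟨fun h j r hr => volume_supportSet_diff_eq_zero hψ hφ h j hr, fun h j r hr => ?_,
    range_analysisOperator_isOrtho hψ hφ⟩
  rw [Set.symmDiff_def]
  exact measure_union_null (volume_supportSet_diff_eq_zero hψ hφ h.le j hr)
    (volume_supportSet_diff_eq_zero hφ hψ h.ge j hr)
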